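/- Let $\mathbb{K}$ be a field, let $m \le n$ be two integers, let $W=(w_1,\dots,w_n)$ be a system of weights (positive integers) and let $D=(d_1,\dots,d_m)$ be a sequence of positive integers. The $W$-degree of a monomial $X_1^{\alpha_1}\cdots X_n^{\alpha_n}$ is $\sum_i w_i\alpha_i$; let $A_{W,D}$ be the affine space over $\mathbb{K}$ of sequences $(f_1,\dots,f_m)$ in $\mathbb{K}[X_1,\dots,X_n]$ such that each $f_i$ is $W$-homogeneous of $W$-degree $d_i$ (the zero polynomial being allowed), its coordinates being the coefficients of the $f_i$. For $i\le n$ let $W_i=(w_1,\dots,w_i)$ (weights on $\mathbb{K}[X_1,\dots,X_i]$), and for $i \le m$ let $D_i=(d_1,\dots,d_i)$. A sequence $D'=(d'_1,\dots,d'_s)$ of positive integers is called $W'$-compatible, for a system of weights $W'=(w'_1,\dots,w'_r)$ with $s\le r$, if there is a regular sequence $(f_1,\dots,f_s)$ in $\mathbb{K}[X_1,\dots,X_r]$ with each $f_i$ being $W'$-homogeneous of $W'$-degree $d'_i$; it is called strongly $W'$-compatible if $w'_i \mid d'_i$ for all $1\le i\le s$. A sequence $(f_1,\dots,f_m)$ in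 $\mathbb{K}[X_1,\dots,X_n]$ generating the ideal $I$ is in Noether position with respect to $X_1,\dots,X_m$ if the classes of $X_1,\dots,X_m$ in $\mathbb{K}[X_1,\dots,X_n]/I$ are integral over $\mathbb{K}[X_{m+1},\dots,X_n]$ and $\mathbb{K}[X_{m+1},\dots,X_n]\cap I=0$. The weights $W$ are reverse chain-divisible if $w_n\mid w_{n-1}\mid\dots\mid w_1$. Then: 1. if $\mathbb{K}$ is infinite and $D$ is $W$-compatible, then the regular sequences form a Zariski-dense subset of $A_{W,D}$; 2. if $\mathbb{K}$ is infinite and $D$ is $W_m$-compatible, then the sequences in Noether position with respect to $X_1,\dots,X_m$ form a Zariski-dense subset of $A_{W,D}$; 3. if $D$ is strongly $W$-compatible, then $D$ is $W$-compatible and $W_m$-compatible, and $D_i$ is $W_i$-compatible for every $1\le i\le m$; 4. if $m=n$, $D$ is $W$-compatible and $W$ is reverse chain-divisible, then some reordering $(d_{\sigma(1)},\dots,d_{\sigma(n)})$ of $D$, with $\sigma$ a permutation of $\{1,\dots,n\}$, is strongly $W$-compatible. -/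

import Mathlib

namespace WeightedSeq

/-- The affine space `A_{W,D}` of sequences `(f_1, …, f_m)` of polynomials in `K[X_1, …, X_n]`,
with `f_i` homogeneous of weighted degree `d_i` for the weights `w` (zero polynomials allowed). -/
abbrev HomSeq (K : Type*) [Field K] {n m : ℕ} (w : Fin n → ℕ) (d : Fin m → ℕ) : Type _ :=
  (i : Fin m) → MvPolynomial.weightedHomogeneousSubmodule K w (d i)

/-- The polynomials of a weighted homogeneous sequence. -/
def HomSeq.polys {K : Type*} [Field K] {n m : ℕ} {w : Fin n → ℕ} {d : Fin m → ℕ}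
    (F : HomSeq K w d) : Fin m → MvPolynomial (Fin n) K :=
  fun i => (F i : MvPolynomial (Fin n) K)

/-- The index set of the coordinates of `A_{W,D}`: an index `i` together with a monomial of
weighted degree `d_i`. -/
abbrev CoordIndex {n m : ℕ} (w : Fin n → ℕ) (d : Fin m → ℕ) : Type :=
  (i : Fin m) × {α : Fin n →₀ ℕ // Finsupp.weight w α = d i}

/-- The coordinates (that is, the coefficients) of a point of `A_{W,D}`. -/
def HomSeq.coords {K : Type*} [Field K] {n m : ℕ} {w : Fin n → ℕ} {d : Fin m → ℕ}
    (F : HomSeq K w d) : CoordIndex w d → K :=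
  fun p => MvPolynomial.coeff p.2.1 (F.polys p.1)

/-- Zariski-closed subsets of `A_{W,D}`: the common zero sets of polynomials in the
coefficients. -/
def IsZariskiClosed {K : Type*} [Field K] {n m : ℕ} {w : Fin n → ℕ} {d : Fin m → ℕ}
    (Z : Set (HomSeq K w d)) : Prop :=
  ∃ S : Set (MvPolynomial (CoordIndex w d) K),
    Z = {F | ∀ P ∈ S, MvPolynomial.eval F.coords P = 0}

/-- `T` is Zariski-dense in `A_{W,D}`: the only Zariski-closed subset containing `T` is the whole
space. -/
def IsZariskiDense {K : Type*} [Field K] {n m : ℕ} {w : Fin n → ℕ} {d : Fin m → ℕ}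
    (T : Set (HomSeq K w d)) : Prop :=
  ∀ Z : Set (HomSeq K w d), IsZariskiClosed Z → T ⊆ Z → Z = Set.univ

/-- `(f_1, …, f_m)` is a regular sequence in `K[X_1, …, X_n]`. -/
def IsRegularSeq {K : Type*} [Field K] {n m : ℕ} (f : Fin m → MvPolynomial (Fin n) K) : Prop :=
  RingTheory.Sequence.IsRegular (MvPolynomial (Fin n) K) (List.ofFn f)

/-- `(f_1, …, f_m)` is in Noether position with respect to `X_1, …, X_m` in `K[X_1, …, X_n]`:
with `I = ⟨f_1, …, f_m⟩`, the classes of `X_1, …, X_m` modulo `I` are integral over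
`K[X_{m+1}, …, X_n]`, and `K[X_{m+1}, …, X_n] ∩ I = 0`. -/
def IsNoetherPosition {K : Type*} [Field K] {n m : ℕ} (hmn : m ≤ n)
    (f : Fin m → MvPolynomial (Fin n) K) : Prop :=
  (∀ i : Fin m,
    IsIntegral (MvPolynomial.supported K {j : Fin n | m ≤ (j : ℕ)})
      (Ideal.Quotient.mk (Ideal.span (Set.range f)) (MvPolynomial.X (Fin.castLE hmn i)))) ∧
  ∀ p ∈ MvPolynomial.supported K {j : Fin n | m ≤ (j : ℕ)},
    p ∈ Ideal.span (Set.range f) → p = 0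

/-- `D = d` is `W`-compatible over `K`, for `W = w`: some weighted homogeneous sequence of weighted
degree `D` in `K[X_1, …, X_n]` is regular. -/
def IsCompatible (K : Type*) [Field K] {n m : ℕ} (w : Fin n → ℕ) (d : Fin m → ℕ) : Prop :=
  ∃ F : HomSeq K w d, IsRegularSeq F.polys

/-- `D = d` is strongly `W`-compatible, for `W = w`: `w_i` divides `d_i` for `1 ≤ i ≤ m`. -/
def IsStronglyCompatible {n m : ℕ} (hmn : m ≤ n) (w : Fin n → ℕ) (d : Fin m → ℕ) : Prop :=
  ∀ i : Fin m, w (Fin.castLE hmn i) ∣ d i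

/-- The truncation `(v_1, …, v_i)` of `v = (v_1, …, v_n)`, for `i ≤ n`. -/
def trunc {n i : ℕ} (hi : i ≤ n) (v : Fin n → ℕ) : Fin i → ℕ :=
  fun j => v (Fin.castLE hi j)

/-- `w_n ∣ w_{n-1} ∣ ⋯ ∣ w_1`. -/
def IsReverseChainDivisible {n : ℕ} (w : Fin n → ℕ) : Prop :=
  ∀ i j : Fin n, (j : ℕ) = (i : ℕ) + 1 → w j ∣ w i

end WeightedSeq

/-! Density (1, 2). Join a good point `F₀` to an arbitrary point by a line with parameter `t`,
viewed as a family over `K[t]`. If only finitely many points of each such line are bad, a polynomial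
vanishing on the good points vanishes on every line, as `K` is infinite. Goodness spreads from `t =
0` by Nakayama in a single weighted degree, where everything is finitely generated over `K[t]`
because the weights are positive. For regularity (`exists_regular_of_eval_ne_zero`), Nakayama shows
that the obstruction `(I_i : f_i) / I_i` is `K[t]`-torsion; one nonzero polynomial kills all the
torsion, and its non-roots are good. For Noether position the spreading condition is that `f_1, …,
f_m, X_{m+1}, …, X_n` generate an ideal containing powers of all variables
(`exists_X_pow_mem_of_eval_ne_zero`). Then `K[X]` is integral over the algebra these `n` polynomials
generate, which is a polynomial ring by transcendence degree; Noether position follows.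

Strong compatibility (3) is witnessed by the powers `X_i ^ (d_i / w_i)`.

Reordering (4). A form whose degree is not divisible by `w_j` lies in the ideal of the variables
after `X_j`. A regular sequence of length `n` cuts out only the origin, so by transcendence degree
at least `j` of the degrees are divisible by `w_j`; Hall's theorem gives the permutation. -/

namespace WeightedSeq

open MvPolynomial

/-! ### Regular sequences in terms of the ideals of initial segments -/

section InitialIdeal

variable {A B : Type*} [CommRing A] [CommRing B] {m : ℕ}

/-- The ideal generated by the first `k` members of a finite sequence. -/
def initialIdeal (f : Fin m → A) (k : ℕ) : Ideal A :=
  Ideal.span (f '' {j | (j : ℕ) < k})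

lemma initialIdeal_zero (f : Fin m → A) : initialIdeal f 0 = ⊥ := by
  simp [initialIdeal]

lemma initialIdeal_self (f : Fin m → A) : initialIdeal f m = Ideal.span (Set.range f) := by
  simp [initialIdeal]

lemma initialIdeal_succ (f : Fin m → A) (i : Fin m) :
    initialIdeal f (i + 1) = initialIdeal f i ⊔ Ideal.span {f i} := by
  have : {j : Fin m | (j : ℕ) < i + 1} = {j : Fin m | (j : ℕ) < i} ∪ {i} := by
    ext j
    simp only [Set.mem_ofPred_eq, Set.mem_union, Set.mem_singleton_iff, Fin.ext_iff]
    omega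
  rw [initialIdeal, this, Set.image_union, Set.image_singleton, Ideal.span_union, initialIdeal]

lemma mem_initialIdeal_succ {f : Fin m → A} {i : Fin m} {x : A} :
    x ∈ initialIdeal f (i + 1) ↔ ∃ y ∈ initialIdeal f i, ∃ z, x = y + f i * z := by
  rw [initialIdeal_succ, Submodule.mem_sup]
  constructor
  · rintro ⟨y, hy, z, hz, rfl⟩
    obtain ⟨c, rfl⟩ := Ideal.mem_span_singleton'.1 hz
    exact ⟨y, hy, c, by ring⟩
  · rintro ⟨y, hy, z, rfl⟩
    exact ⟨y, hy, f i * z, Ideal.mul_mem_right _ _ (Ideal.mem_span_singleton_self _), rfl⟩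

lemma map_initialIdeal (φ : A →+* B) (f : Fin m → A) (k : ℕ) :
    (initialIdeal f k).map φ = initialIdeal (fun i => φ (f i)) k := by
  rw [initialIdeal, Ideal.map_span, ← Set.image_comp]; rfl

lemma map_mem_initialIdeal (φ : A →+* B) {f : Fin m → A} {k : ℕ} {x : A}
    (hx : x ∈ initialIdeal f k) : φ x ∈ initialIdeal (fun i => φ (f i)) k := by
  rw [← map_initialIdeal]
  exact Ideal.mem_map_of_mem φ hx

lemma exists_mem_initialIdeal_of_surjective {φ : A →+* B} (hφ : Function.Surjective φ)
    {f : Fin m → A} {k : ℕ} {y : B} (hy : y ∈ initialIdeal (fun i => φ (f i)) k) :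
    ∃ x ∈ initialIdeal f k, φ x = y := by
  rw [← map_initialIdeal] at hy
  exact (Ideal.mem_map_iff_of_surjective φ hφ).1 hy

lemma ofList_take_ofFn (f : Fin m → A) (k : ℕ) :
    Ideal.ofList ((List.ofFn f).take k) = initialIdeal f k := by
  unfold Ideal.ofList initialIdeal
  congr 1
  ext x
  simp only [Set.mem_ofPred_eq, List.mem_take_iff_getElem, Set.mem_image, List.length_ofFn,
    List.getElem_ofFn]
  constructor
  · rintro ⟨j, hj, rfl⟩
    exact ⟨⟨j, (lt_min_iff.1 hj).2⟩, (lt_min_iff.1 hj).1, rfl⟩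
  · rintro ⟨j, hj, rfl⟩
    exact ⟨j, lt_min hj j.2, rfl⟩

lemma isRegular_ofFn_iff (f : Fin m → A) :
    RingTheory.Sequence.IsRegular A (List.ofFn f) ↔
      (∀ (i : Fin m) (x : A), f i * x ∈ initialIdeal f i → x ∈ initialIdeal f i) ∧
        initialIdeal f m ≠ ⊤ := by
  rw [RingTheory.Sequence.isRegular_iff, RingTheory.Sequence.isWeaklyRegular_iff]
  have h (k : ℕ) : Ideal.ofList ((List.ofFn f).take k) • (⊤ : Ideal A) = initialIdeal f k := by
    rw [ofList_take_ofFn, smul_eq_mul, Ideal.mul_top]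
  have hm : Ideal.ofList (List.ofFn f) • (⊤ : Ideal A) = initialIdeal f m := by
    rw [← h, List.take_of_length_le (by simp)]
  rw [hm, ne_comm (a := (⊤ : Ideal A))]
  refine and_congr_left fun _ => ⟨fun H i x hx => ?_, fun H i hi => ?_⟩
  · have := (isSMulRegular_quotient_iff_mem_of_smul_mem _ _).1 (H i (by simp)) x
    rw [h, List.getElem_ofFn] at this
    exact this hx
  · refine (isSMulRegular_quotient_iff_mem_of_smul_mem _ _).2 fun x hx => ?_
    rw [h, List.getElem_ofFn] at hx
    rw [h]
    exact H ⟨i, by simpa using hi⟩ x hx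

end InitialIdeal

/-! ### Weighted homogeneous components and homogeneous ideals -/

section Graded

attribute [local instance] MvPolynomial.weightedGradedAlgebra

variable {σ R : Type*} [CommRing R] {w : σ → ℕ}

lemma weightedHomogeneousComponent_mul {f : MvPolynomial σ R} {d : ℕ}
    (hf : f.IsWeightedHomogeneous w d) (x : MvPolynomial σ R) (k : ℕ) :
    weightedHomogeneousComponent w (d + k) (f * x) =
      f * weightedHomogeneousComponent w k x := by
  simp only [← weightedDecomposition.decompose'_apply]
  exact DirectSum.coe_decompose_mul_add_of_left_mem (weightedHomogeneousSubmodule R w) hf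

lemma weightedHomogeneousComponent_mul_of_lt {f : MvPolynomial σ R} {d : ℕ}
    (hf : f.IsWeightedHomogeneous w d) (x : MvPolynomial σ R) {k : ℕ} (hk : k < d) :
    weightedHomogeneousComponent w k (f * x) = 0 := by
  simp only [← weightedDecomposition.decompose'_apply]
  exact DirectSum.coe_decompose_mul_of_left_mem_of_not_le (weightedHomogeneousSubmodule R w) hf
    (not_le.2 hk)

lemma isHomogeneous_span {s : Set (MvPolynomial σ R)}
    (hs : ∀ x ∈ s, ∃ d, IsWeightedHomogeneous w x d) :
    (Ideal.span s).IsHomogeneous (weightedHomogeneousSubmodule R w) :=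
  Ideal.homogeneous_span _ _ hs

lemma component_mem_span {s : Set (MvPolynomial σ R)}
    (hs : ∀ x ∈ s, ∃ d, IsWeightedHomogeneous w x d) {x : MvPolynomial σ R}
    (hx : x ∈ Ideal.span s) (k : ℕ) : weightedHomogeneousComponent w k x ∈ Ideal.span s :=
  weightedHomogeneousComponent_mem_of_mem R w (isHomogeneous_span hs) hx k

lemma component_mem_initialIdeal {m : ℕ} {f : Fin m → MvPolynomial σ R} {d : Fin m → ℕ}
    (hf : ∀ i, (f i).IsWeightedHomogeneous w (d i)) {k : ℕ} {x : MvPolynomial σ R}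
    (hx : x ∈ initialIdeal f k) (e : ℕ) :
    weightedHomogeneousComponent w e x ∈ initialIdeal f k :=
  component_mem_span (by rintro _ ⟨i, -, rfl⟩; exact ⟨_, hf i⟩) hx e

lemma mem_of_forall_component_mem {I : Ideal (MvPolynomial σ R)} {x : MvPolynomial σ R}
    (h : ∀ e, weightedHomogeneousComponent w e x ∈ I) : x ∈ I := by
  rw [← sum_weightedHomogeneousComponent w x,
    finsum_eq_sum _ (weightedHomogeneousComponent_finsupp x)]
  exact Ideal.sum_mem _ fun e _ => h e

end Graded

/-! ### Regularity for forms of positive degree -/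

section Lists

variable {n m : ℕ} {K : Type*} [Field K]

lemma isRegularSeq_iff (f : Fin m → MvPolynomial (Fin n) K) :
    IsRegularSeq f ↔
      (∀ (i : Fin m) (x), f i * x ∈ initialIdeal f i → x ∈ initialIdeal f i) ∧
        initialIdeal f m ≠ ⊤ :=
  isRegular_ofFn_iff f

/-- Weighted homogeneous polynomials of positive degree generate a proper ideal. -/
lemma span_range_ne_top {ι σ : Type*} {w : σ → ℕ} {g : ι → MvPolynomial σ K} {e : ι → ℕ}
    (he : ∀ i, 0 < e i) (hg : ∀ i, (g i).IsWeightedHomogeneous w (e i)) :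
    Ideal.span (Set.range g) ≠ ⊤ := by
  intro h
  have : Ideal.span (Set.range g) ≤ RingHom.ker (constantCoeff (σ := σ) (R := K)) := by
    rw [Ideal.span_le]
    rintro _ ⟨i, rfl⟩
    rw [SetLike.mem_coe, RingHom.mem_ker, constantCoeff_eq]
    exact (hg i).coeff_eq_zero 0 (by simpa using (he i).ne)
  rw [h, top_le_iff] at this
  exact RingHom.ker_ne_top _ this

lemma isRegularSeq_iff_of_homogeneous {w : Fin n → ℕ} {d : Fin m → ℕ} (hd : ∀ i, 0 < d i)
    {f : Fin m → MvPolynomial (Fin n) K} (hf : ∀ i, (f i).IsWeightedHomogeneous w (d i)) :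
    IsRegularSeq f ↔ ∀ (i : Fin m) (x), f i * x ∈ initialIdeal f i → x ∈ initialIdeal f i := by
  rw [isRegularSeq_iff, initialIdeal_self]
  exact and_iff_left (span_range_ne_top hd hf)

end Lists

/-! ### Zariski density tested on lines -/

section Density

variable {K : Type*} [Field K] {n m : ℕ} {w : Fin n → ℕ} {d : Fin m → ℕ}

/-- A set is Zariski-dense if all but finitely many points of every line through some fixed point
belong to it. -/
lemma isZariskiDense_of_lines [Infinite K] {T : Set (HomSeq K w d)} (F₀ : HomSeq K w d)
    (h : ∀ G : HomSeq K w d, {c : K | F₀ + c • G ∉ T}.Finite) : IsZariskiDense T := by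
  rintro Z ⟨S, rfl⟩ hT
  rw [Set.eq_univ_iff_forall]
  intro F P hP
  -- With this direction the line meets `F` at parameter 1; `q` is `P` restricted to the line.
  set G := F - F₀ with hG
  set q : Polynomial K := MvPolynomial.aeval
    (fun p => Polynomial.C (F₀.coords p) + Polynomial.X * Polynomial.C (G.coords p)) P with hq
  have heval : ∀ c : K, q.eval c = MvPolynomial.eval (F₀ + c • G).coords P := by
    intro c
    rw [hq, ← Polynomial.coe_evalRingHom, MvPolynomial.map_aeval, MvPolynomial.eval,
      MvPolynomial.coe_eval₂Hom, MvPolynomial.coe_eval₂Hom]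
    congr 1
    · ext; simp
    · ext p
      simp only [HomSeq.coords, HomSeq.polys]
      simp
      ring
  have hq0 : q = 0 := by
    refine Polynomial.eq_zero_of_infinite_isRoot q ?_
    refine Set.Infinite.mono ?_ (h G).infinite_compl
    intro c hc
    simp only [Set.mem_compl_iff, Set.mem_ofPred_eq, not_not] at hc
    have := hT hc P hP
    rwa [← heval] at this
  have := heval 1
  rw [hq0, one_smul, hG, add_sub_cancel, Polynomial.eval_zero] at this
  exact this.symm

end Density

/-! ### Spreading regularity along a one-parameter family -/

section OneParameter

variable {K σ : Type*} [Field K]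

/-- Specialization of the parameter of a one-parameter family of polynomials. -/
noncomputable def specialize (c : K) : MvPolynomial σ (Polynomial K) →+* MvPolynomial σ K :=
  MvPolynomial.map (Polynomial.evalRingHom c)

@[simp] lemma specialize_C (c : K) (p : Polynomial K) :
    specialize (σ := σ) c (C p) = C (p.eval c) := by
  simp [specialize]

@[simp] lemma specialize_X (c : K) (i : σ) : specialize c (X i) = X i := by
  simp [specialize]

@[simp] lemma specialize_map_C (c : K) (x : MvPolynomial σ K) :
    specialize c (MvPolynomial.map Polynomial.C x) = x := by
  rw [specialize, MvPolynomial.map_map]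
  convert MvPolynomial.map_id x
  ext; simp

lemma specialize_surjective (c : K) : Function.Surjective (specialize (σ := σ) c) :=
  fun x => ⟨_, specialize_map_C c x⟩

lemma specialize_eq_zero_iff {c : K} {x : MvPolynomial σ (Polynomial K)} :
    specialize c x = 0 ↔ ∃ z, x = C (Polynomial.X - Polynomial.C c) * z := by
  rw [specialize, ← MvPolynomial.C_dvd_iff_map_hom_eq_zero (r := Polynomial.X - Polynomial.C c)]
  · rfl
  · intro p
    rw [Polynomial.dvd_iff_isRoot]; rfl

lemma IsWeightedHomogeneous.specialize {w : σ → ℕ} {d : ℕ} {x : MvPolynomial σ (Polynomial K)}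
    (hx : x.IsWeightedHomogeneous w d) (c : K) :
    (specialize c x).IsWeightedHomogeneous w d := by
  intro a ha
  refine hx fun h => ha ?_
  rw [WeightedSeq.specialize, MvPolynomial.coeff_map, h, map_zero]

/-- Nakayama's lemma over the polynomial ring in the parameter, within one weighted degree. -/
lemma exists_eval_zero_eq_one_of_le [Finite σ] {w : σ → ℕ} (hw : ∀ i, 0 < w i) {k : ℕ}
    {E : Submodule (Polynomial K) (MvPolynomial σ (Polynomial K))}
    (hE : E ≤ weightedHomogeneousSubmodule (Polynomial K) w k)
    {I : Ideal (MvPolynomial σ (Polynomial K))}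
    (h : ∀ x ∈ E, ∃ y ∈ I, ∃ z ∈ E, x = y + C Polynomial.X * z) :
    ∃ p : Polynomial K, p.eval 0 = 1 ∧ ∀ x ∈ E, C p * x ∈ I := by
  have hfg : E.FG := Submodule.FG.of_le
    (weightedHomogeneousSubmodule_fg (Polynomial K) w (fun i => (hw i).ne') k) hE
  obtain ⟨p, hp, hpE⟩ := Submodule.exists_sub_one_mem_and_smul_le_of_fg_of_le_sup
    (I := Ideal.span {(Polynomial.X : Polynomial K)}) (N := I.restrictScalars (Polynomial K))
    (N' := E) (P := E) hfg le_rfl (by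
      intro x hx
      obtain ⟨y, hy, z, hz, rfl⟩ := h x hx
      refine Submodule.add_mem_sup hy ?_
      rw [← smul_eq_C_mul]
      exact Submodule.smul_mem_smul (Ideal.mem_span_singleton_self _) hz)
  refine ⟨p, ?_, fun x hx => ?_⟩
  · obtain ⟨q, hq⟩ := Ideal.mem_span_singleton'.1 hp
    have := congrArg (Polynomial.eval 0) hq
    simp only [Polynomial.eval_mul, Polynomial.eval_X, mul_zero, Polynomial.eval_sub,
      Polynomial.eval_one] at this
    exact (sub_eq_zero.1 this.symm)
  · rw [← smul_eq_C_mul]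
    exact hpE (Submodule.smul_mem_pointwise_smul x p E hx)

/-- The elements of a one-parameter family that a nonzero polynomial in the parameter multiplies
into a given ideal. -/
def torsionClosure (I : Ideal (MvPolynomial σ (Polynomial K))) :
    Ideal (MvPolynomial σ (Polynomial K)) where
  carrier := {x | ∃ p : Polynomial K, p ≠ 0 ∧ C p * x ∈ I}
  zero_mem' := ⟨1, one_ne_zero, by simp⟩
  add_mem' := by
    rintro x y ⟨p, hp, hx⟩ ⟨q, hq, hy⟩
    refine ⟨p * q, mul_ne_zero hp hq, ?_⟩
    rw [C_mul, show C p * C q * (x + y) = C q * (C p * x) + C p * (C q * y) by ring]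
    exact I.add_mem (I.mul_mem_left _ hx) (I.mul_mem_left _ hy)
  smul_mem' := by
    rintro a x ⟨p, hp, hx⟩
    refine ⟨p, hp, ?_⟩
    rw [smul_eq_mul, mul_left_comm]
    exact I.mul_mem_left _ hx

lemma mem_torsionClosure {I : Ideal (MvPolynomial σ (Polynomial K))}
    {x : MvPolynomial σ (Polynomial K)} :
    x ∈ torsionClosure I ↔ ∃ p : Polynomial K, p ≠ 0 ∧ C p * x ∈ I := Iff.rfl

/-- By noetherianity the torsion has finitely many generators; the product of their annihilators
works uniformly. -/
lemma exists_mul_torsionClosure_mem [Finite σ] (I : Ideal (MvPolynomial σ (Polynomial K))) :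
    ∃ h : Polynomial K, h ≠ 0 ∧ ∀ x ∈ torsionClosure I, C h * x ∈ I := by
  obtain ⟨s, hs⟩ := IsNoetherian.noetherian (torsionClosure I)
  have hmem : ∀ x : s, ∃ p : Polynomial K, p ≠ 0 ∧ C p * (x : MvPolynomial σ (Polynomial K)) ∈ I :=
    fun x => mem_torsionClosure.1 (hs ▸ Submodule.subset_span x.2)
  choose p hp hpI using hmem
  refine ⟨∏ x, p x, Finset.prod_ne_zero_iff.2 fun x _ => hp x, fun x hx => ?_⟩
  rw [← hs] at hx
  induction hx using Submodule.span_induction with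
  | mem x hx =>
    obtain ⟨q, hq⟩ := Finset.dvd_prod_of_mem p (Finset.mem_univ ⟨x, hx⟩)
    rw [hq, C_mul, mul_comm (C _) (C q), mul_assoc]
    exact I.mul_mem_left _ (hpI ⟨x, hx⟩)
  | zero => simp
  | add x y _ _ hx hy => rw [mul_add]; exact I.add_mem hx hy
  | smul a x _ hx => rw [smul_eq_mul, mul_left_comm]; exact I.mul_mem_left _ hx

/-- If `h` kills the torsion modulo `I` then the quotient by `I` has no torsion at parameters
outside the zeros of `h`. -/
lemma mem_of_C_X_sub_C_mul_mem {I : Ideal (MvPolynomial σ (Polynomial K))} {h : Polynomial K}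
    (hI : ∀ x ∈ torsionClosure I, C h * x ∈ I) {c : K} (hc : h.eval c ≠ 0)
    {x : MvPolynomial σ (Polynomial K)} (hx : C (Polynomial.X - Polynomial.C c) * x ∈ I) :
    x ∈ I := by
  have h1 : C h * x ∈ I := hI x ⟨_, Polynomial.X_sub_C_ne_zero c, hx⟩
  have hcop : IsCoprime (Polynomial.X - Polynomial.C c) h :=
    ((Polynomial.irreducible_X_sub_C c).coprime_iff_not_dvd).2
      fun hdvd => hc (Polynomial.dvd_iff_isRoot.1 hdvd)
  obtain ⟨a, b, hab⟩ := hcop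
  have : x = C a * (C (Polynomial.X - Polynomial.C c) * x) + C b * (C h * x) := by
    rw [← mul_assoc, ← mul_assoc, ← C_mul, ← C_mul, ← add_mul, ← C_add, hab, C_1, one_mul]
  rw [this]
  exact I.add_mem (I.mul_mem_left _ hx) (I.mul_mem_left _ h1)

variable {m : ℕ} {w : σ → ℕ} {d : Fin m → ℕ} {f : Fin m → MvPolynomial σ (Polynomial K)}

/-- Specialization at `c` is surjective with kernel generated by `t - c`. -/
lemma exists_eq_add_of_specialize_mem {c : K} {k : ℕ} {x : MvPolynomial σ (Polynomial K)}
    (hx : specialize c x ∈ initialIdeal (fun i => specialize c (f i)) k) :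
    ∃ y ∈ initialIdeal f k, ∃ z, x = y + C (Polynomial.X - Polynomial.C c) * z := by
  obtain ⟨y, hy, hxy⟩ := exists_mem_initialIdeal_of_surjective (specialize_surjective c) hx
  have : specialize c (x - y) = 0 := by rw [map_sub, hxy, sub_self]
  obtain ⟨z, hz⟩ := specialize_eq_zero_iff.1 this
  exact ⟨y, hy, z, by rw [← hz]; ring⟩

/-- Regularity at `t = 0` makes `t` a nonzerodivisor modulo each initial ideal. If `t x = y + f_k
z`, then at `t = 0` regularity puts `z` in the initial ideal up to a multiple `t z'`, and `x - f_k
z'` falls under the induction hypothesis. -/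
lemma mem_initialIdeal_of_C_X_mul_mem
    (hreg : ∀ (i : Fin m) (x),
      specialize 0 (f i) * x ∈ initialIdeal (fun j => specialize 0 (f j)) i →
        x ∈ initialIdeal (fun j => specialize 0 (f j)) i)
    {k : ℕ} (hk : k ≤ m) {x : MvPolynomial σ (Polynomial K)}
    (hx : C Polynomial.X * x ∈ initialIdeal f k) : x ∈ initialIdeal f k := by
  induction k generalizing x with
  | zero =>
    rw [initialIdeal_zero, Ideal.mem_bot] at hx ⊢
    exact (mul_eq_zero.1 hx).resolve_left (by simp)
  | succ k ih =>
    obtain ⟨y, hy, z, hyz⟩ := (mem_initialIdeal_succ (i := ⟨k, hk⟩)).1 hx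
    have h0 : specialize 0 (f ⟨k, hk⟩ * z) ∈ initialIdeal (fun j => specialize 0 (f j)) k := by
      rw [← add_sub_cancel_left y (f ⟨k, hk⟩ * z), ← hyz, map_sub, map_mul, specialize_C]
      simpa using map_mem_initialIdeal (specialize 0) hy
    rw [map_mul] at h0
    obtain ⟨y', hy', z', rfl⟩ := exists_eq_add_of_specialize_mem (hreg ⟨k, hk⟩ _ h0)
    rw [Polynomial.C_0, sub_zero] at hyz
    have h1 : x - f ⟨k, hk⟩ * z' ∈ initialIdeal f k := by
      refine ih (by omega) ?_
      rw [mul_sub, hyz, show y + f ⟨k, hk⟩ * (y' + C Polynomial.X * z') -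
        C Polynomial.X * (f ⟨k, hk⟩ * z') = y + f ⟨k, hk⟩ * y' by ring]
      exact Ideal.add_mem _ hy (Ideal.mul_mem_left _ _ hy')
    exact (mem_initialIdeal_succ (i := ⟨k, hk⟩)).2 ⟨_, h1, z', by ring⟩

/-- Let `E` be the degree `e` part of the colon ideal `(I_i : f_i)`. Regularity at `t = 0`, together
with `t` being a nonzerodivisor modulo `I_i`, gives `E ⊆ I_i + t E`, so Nakayama finds `p` with
`p(0) = 1` and `p E ⊆ I_i`. -/
lemma mem_torsionClosure_of_mul_mem [Finite σ] (hw : ∀ i, 0 < w i)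
    (hf : ∀ i, (f i).IsWeightedHomogeneous w (d i))
    (hreg : ∀ (i : Fin m) (x),
      specialize 0 (f i) * x ∈ initialIdeal (fun j => specialize 0 (f j)) i →
        x ∈ initialIdeal (fun j => specialize 0 (f j)) i)
    {i : Fin m} {x : MvPolynomial σ (Polynomial K)} (hx : f i * x ∈ initialIdeal f i) :
    x ∈ torsionClosure (initialIdeal f i) := by
  refine mem_of_forall_component_mem (w := w) fun e => ?_
  let E : Submodule (Polynomial K) (MvPolynomial σ (Polynomial K)) :=
    weightedHomogeneousSubmodule (Polynomial K) w e ⊓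
      ((initialIdeal f i).restrictScalars (Polynomial K)).comap
        (LinearMap.mulLeft (Polynomial K) (f i))
  have hE : ∀ z, z ∈ E ↔ z.IsWeightedHomogeneous w e ∧ f i * z ∈ initialIdeal f i :=
    fun z => Iff.rfl
  obtain ⟨p, hp, hpE⟩ := exists_eval_zero_eq_one_of_le hw (E := E) (I := initialIdeal f i)
    inf_le_left (by
      intro z hz
      obtain ⟨hze, hzi⟩ := (hE z).1 hz
      have h0 := map_mem_initialIdeal (specialize 0) hzi
      rw [map_mul] at h0
      obtain ⟨y, hy, z', hyz⟩ := exists_eq_add_of_specialize_mem (hreg i _ h0)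
      rw [Polynomial.C_0, sub_zero] at hyz
      refine ⟨weightedHomogeneousComponent w e y, component_mem_initialIdeal hf hy e,
        weightedHomogeneousComponent w e z', (hE _).2
          ⟨weightedHomogeneousComponent_isWeightedHomogeneous _ _, ?_⟩, ?_⟩
      · rw [← weightedHomogeneousComponent_mul (hf i)]
        refine component_mem_initialIdeal hf
          (mem_initialIdeal_of_C_X_mul_mem hreg i.2.le ?_) _
        rw [show C Polynomial.X * (f i * z') = f i * z - f i * y by rw [hyz]; ring]
        exact Ideal.sub_mem _ hzi (Ideal.mul_mem_left _ _ hy)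
      · rw [← weightedHomogeneousComponent_C_mul, ← map_add, ← hyz,
          hze.weightedHomogeneousComponent_same])
  refine ⟨p, fun h => by simp [h] at hp, hpE _ ((hE _).2
    ⟨weightedHomogeneousComponent_isWeightedHomogeneous _ _, ?_⟩)⟩
  rw [← weightedHomogeneousComponent_mul (hf i)]
  exact component_mem_initialIdeal hf hx _

/-- If a one-parameter family of weighted homogeneous sequences is regular at the parameter `0`, it
is regular at all but finitely many parameters. -/
lemma exists_regular_of_eval_ne_zero [Finite σ] (hw : ∀ i, 0 < w i)
    (hf : ∀ i, (f i).IsWeightedHomogeneous w (d i))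
    (hreg : ∀ (i : Fin m) (x),
      specialize 0 (f i) * x ∈ initialIdeal (fun j => specialize 0 (f j)) i →
        x ∈ initialIdeal (fun j => specialize 0 (f j)) i) :
    ∃ h : Polynomial K, h ≠ 0 ∧ ∀ c, h.eval c ≠ 0 → ∀ (i : Fin m) (x),
      specialize c (f i) * x ∈ initialIdeal (fun j => specialize c (f j)) i →
        x ∈ initialIdeal (fun j => specialize c (f j)) i := by
  choose h hh0 hh using fun k : ℕ => exists_mul_torsionClosure_mem (initialIdeal f k)
  refine ⟨∏ k ∈ Finset.range (m + 1), h k, Finset.prod_ne_zero_iff.2 fun k _ => hh0 k, ?_⟩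
  intro c hc i x hx
  have hc' : ∀ k ≤ m, (h k).eval c ≠ 0 := by
    intro k hk hk0
    refine hc ?_
    rw [Polynomial.eval_prod]
    exact Finset.prod_eq_zero (Finset.mem_range.2 (by omega)) hk0
  obtain ⟨x, rfl⟩ := specialize_surjective c x
  rw [← map_mul] at hx
  obtain ⟨y, hy, z, hz⟩ := exists_eq_add_of_specialize_mem hx
  -- Here `(t - c) z = f_i x - y` lies in the next initial ideal, modulo which `t - c` is a
  -- nonzerodivisor.
  have hz1 : z ∈ initialIdeal f (i + 1) := by
    refine mem_of_C_X_sub_C_mul_mem (hh (i + 1)) (hc' _ i.2) ?_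
    exact mem_initialIdeal_succ.2 ⟨-y, neg_mem hy, x, by rw [hz]; ring⟩
  obtain ⟨y', hy', z', rfl⟩ := mem_initialIdeal_succ.1 hz1
  -- The correction by `(t - c) z'` vanishes at `c`, and `h i` becomes a unit there.
  have h2 : x - C (Polynomial.X - Polynomial.C c) * z' ∈ torsionClosure (initialIdeal f i) := by
    refine mem_torsionClosure_of_mul_mem hw hf hreg ?_
    rw [show f i * (x - C (Polynomial.X - Polynomial.C c) * z') =
      y + C (Polynomial.X - Polynomial.C c) * y' by rw [mul_sub, hz]; ring]
    exact Ideal.add_mem _ hy (Ideal.mul_mem_left _ _ hy')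
  have h3 := map_mem_initialIdeal (specialize c) (hh i _ h2)
  rw [map_mul, map_sub, map_mul, specialize_C, specialize_C] at h3
  simp only [Polynomial.eval_sub, Polynomial.eval_X, Polynomial.eval_C, sub_self, C_0, zero_mul,
    sub_zero] at h3
  have h4 := Ideal.mul_mem_left _ (C ((h i).eval c)⁻¹) h3
  rwa [← mul_assoc, ← C_mul, inv_mul_cancel₀ (hc' _ i.2.le), C_1, one_mul] at h4

end OneParameter

/-! ### Density of regular sequences -/

section Lines

variable {K : Type*} [Field K] {n m : ℕ} {w : Fin n → ℕ} {d : Fin m → ℕ}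

/-- The line through `F` in the direction of `G`, as a one-parameter family. -/
noncomputable def linePolys (F G : HomSeq K w d) (i : Fin m) :
    MvPolynomial (Fin n) (Polynomial K) :=
  MvPolynomial.map Polynomial.C (F.polys i) +
    C Polynomial.X * MvPolynomial.map Polynomial.C (G.polys i)

lemma linePolys_isWeightedHomogeneous (F G : HomSeq K w d) (i : Fin m) :
    (linePolys F G i).IsWeightedHomogeneous w (d i) := by
  have h (H : HomSeq K w d) :
      (MvPolynomial.map (Polynomial.C : K →+* _) (H.polys i)).IsWeightedHomogeneous w (d i) := by
    intro a ha
    refine (H i).2 fun h => ha ?_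
    rw [MvPolynomial.coeff_map, HomSeq.polys, h, map_zero]
  exact (h F).add ((h G).C_mul _)

lemma specialize_linePolys (F G : HomSeq K w d) (c : K) :
    (fun i => specialize c (linePolys F G i)) = (F + c • G).polys := by
  ext1 i
  simp [linePolys, HomSeq.polys, smul_eq_C_mul]

lemma HomSeq.isWeightedHomogeneous (F : HomSeq K w d) (i : Fin m) :
    (F.polys i).IsWeightedHomogeneous w (d i) := (F i).2

lemma isZariskiDense_isRegularSeq [Infinite K] (hw : ∀ i, 0 < w i) (hd : ∀ i, 0 < d i)
    (h : IsCompatible K w d) :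
    IsZariskiDense {F : HomSeq K w d | IsRegularSeq F.polys} := by
  obtain ⟨F₀, hF₀⟩ := h
  rw [isRegularSeq_iff_of_homogeneous hd F₀.isWeightedHomogeneous] at hF₀
  refine isZariskiDense_of_lines F₀ fun G => ?_
  have hspec (c : K) (i : Fin m) : specialize c (linePolys F₀ G i) = (F₀ + c • G).polys i :=
    congrFun (specialize_linePolys F₀ G c) i
  obtain ⟨h, h0, hh⟩ := exists_regular_of_eval_ne_zero hw (linePolys_isWeightedHomogeneous F₀ G)
    (by simpa only [hspec, zero_smul, add_zero] using hF₀)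
  refine (Polynomial.finite_setOfPred_isRoot h0).subset fun c hc => ?_
  by_contra hne
  refine hc ?_
  rw [Set.mem_ofPred_eq, isRegularSeq_iff_of_homogeneous hd (F₀ + c • G).isWeightedHomogeneous]
  simpa only [hspec] using hh c hne

end Lines

/-! ### Integrality over an algebra generated by forms -/

section Integral

variable {K : Type*} [Field K] {n : ℕ} {w : Fin n → ℕ} {ι : Type*}

/-- An ideal containing powers of all variables contains all polynomials of large weighted
degree. -/
lemma mem_of_forall_X_pow_mem {R σ : Type*} [CommRing R] [Fintype σ] {w : σ → ℕ}
    {I : Ideal (MvPolynomial σ R)} {N : ℕ} (hI : ∀ j, X j ^ N ∈ I) {k : ℕ}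
    (hk : N * ∑ j, w j < k) {x : MvPolynomial σ R} (hx : x.IsWeightedHomogeneous w k) : x ∈ I := by
  rw [x.as_sum]
  refine Ideal.sum_mem _ fun a ha => ?_
  have ha' := hx (mem_support_iff.1 ha)
  -- Pigeonhole: with all exponents below `N`, the weighted degree is at most `N * ∑ j, w j`.
  obtain ⟨j, hj⟩ : ∃ j, N ≤ a j := by
    by_contra! h
    rw [Finsupp.weight_apply, Finsupp.sum_fintype _ _ (by simp)] at ha'
    refine absurd hk (not_lt.2 ?_)
    rw [← ha', Finset.mul_sum]
    exact Finset.sum_le_sum fun j _ => by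
      rw [smul_eq_mul]; exact Nat.mul_le_mul_right _ (h j).le
  have : monomial a (coeff a x) = X j ^ N * monomial (a - Finsupp.single j N) (coeff a x) := by
    rw [X_pow_eq_monomial, monomial_mul, one_mul, add_tsub_cancel_of_le]
    simpa using hj
  rw [this]
  exact I.mul_mem_right _ (hI j)

/-- If weighted homogeneous polynomials of positive degree generate an ideal that contains powers
of all variables, then the polynomial ring is integral over the algebra they generate. -/
lemma isIntegral_adjoin_range [Fintype ι] (hw : ∀ i, 0 < w i) {g : ι → MvPolynomial (Fin n) K}
    {e : ι → ℕ} (he : ∀ i, 0 < e i) (hg : ∀ i, (g i).IsWeightedHomogeneous w (e i)) {N : ℕ}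
    (hN : ∀ j, X j ^ N ∈ Ideal.span (Set.range g)) :
    Algebra.IsIntegral (Algebra.adjoin K (Set.range g)) (MvPolynomial (Fin n) K) := by
  set S := Algebra.adjoin K (Set.range g) with hS
  let V : Set (MvPolynomial (Fin n) K) :=
    (fun a => monomial a (1 : K)) '' {a | Finsupp.weight w a ≤ N * ∑ j, w j}
  have hV : V.Finite := by
    refine Set.Finite.image _ ?_
    refine ((Set.finite_Iic (N * ∑ j, w j)).biUnion fun k _ =>
      Finsupp.finite_of_nat_weight_eq w (fun i => (hw i).ne') k).subset ?_
    intro a ha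
    exact Set.mem_biUnion (x := Finsupp.weight w a) ha rfl
  have key : ∀ (k : ℕ) (x : MvPolynomial (Fin n) K), x.IsWeightedHomogeneous w k →
      x ∈ Submodule.span S V := by
    intro k
    induction k using Nat.strong_induction_on with
    | _ k ih =>
    intro x hx
    rcases le_or_gt k (N * ∑ j, w j) with hk | hk
    · rw [x.as_sum]
      refine Submodule.sum_mem _ fun a ha => ?_
      have : monomial a (coeff a x) = algebraMap K S (coeff a x) • monomial a (1 : K) := by
        rw [algebraMap_smul, smul_monomial, smul_eq_mul, mul_one]
      rw [this]
      refine Submodule.smul_mem _ _ (Submodule.subset_span ⟨a, ?_, rfl⟩)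
      exact (hx (mem_support_iff.1 ha)).le.trans hk
    · obtain ⟨c, hc⟩ := Ideal.mem_span_range_iff_exists_fun.1 (mem_of_forall_X_pow_mem hN hk hx)
      -- Taking degree `k` components makes the cofactor of `g i` a form of degree `k - e i < k`, or
      -- kills the term.
      rw [← hx.weightedHomogeneousComponent_same, ← hc, map_sum]
      refine Submodule.sum_mem _ fun i _ => ?_
      rw [mul_comm]
      rcases lt_or_ge k (e i) with hki | hki
      · rw [weightedHomogeneousComponent_mul_of_lt (hg i) _ hki]
        exact zero_mem _
      · obtain ⟨l, rfl⟩ := Nat.exists_eq_add_of_le hki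
        rw [weightedHomogeneousComponent_mul (hg i)]
        exact Submodule.smul_mem _ (⟨g i, Algebra.subset_adjoin ⟨i, rfl⟩⟩ : S)
          (ih l (by have := he i; omega) _ (weightedHomogeneousComponent_isWeightedHomogeneous _ _))
  have : Module.Finite S (MvPolynomial (Fin n) K) := by
    refine ⟨Submodule.fg_def.2 ⟨V, hV, eq_top_iff.2 fun x _ => ?_⟩⟩
    rw [← sum_weightedHomogeneousComponent w x,
      finsum_eq_sum _ (weightedHomogeneousComponent_finsupp x)]
    exact Submodule.sum_mem _ fun k _ =>
      key k _ (weightedHomogeneousComponent_isWeightedHomogeneous _ _)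
  exact Algebra.IsIntegral.of_finite _ _

/-- Integrality bounds the transcendence degree `n` by the number of generators. -/
lemma le_card_of_X_pow_mem_span [Fintype ι] (hw : ∀ i, 0 < w i) {g : ι → MvPolynomial (Fin n) K}
    {e : ι → ℕ} (he : ∀ i, 0 < e i) (hg : ∀ i, (g i).IsWeightedHomogeneous w (e i)) {N : ℕ}
    (hN : ∀ j, X j ^ N ∈ Ideal.span (Set.range g)) : n ≤ Fintype.card ι := by
  have := isIntegral_adjoin_range hw he hg hN
  have h1 := Algebra.IsAlgebraic.trdeg_le_cardinalMk K (Set.range g)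
  rw [MvPolynomial.trdeg_of_isDomain, Cardinal.mk_fin, Cardinal.lift_natCast] at h1
  have h2 : n ≤ (Set.range g).ncard := by
    rw [← Nat.card_coe_set_eq, Nat.card]
    exact_mod_cast (Cardinal.toNat_le_toNat h1 (Cardinal.lt_aleph0_of_finite _))
  refine h2.trans ?_
  rw [← Set.image_univ, ← Nat.card_eq_fintype_card, ← Set.ncard_univ]
  exact Set.ncard_image_le

lemma algebraicIndependent_of_X_pow_mem_span (hw : ∀ i, 0 < w i)
    {g : Fin n → MvPolynomial (Fin n) K} {e : Fin n → ℕ} (he : ∀ i, 0 < e i)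
    (hg : ∀ i, (g i).IsWeightedHomogeneous w (e i)) {N : ℕ}
    (hN : ∀ j, X j ^ N ∈ Ideal.span (Set.range g)) : AlgebraicIndependent K g := by
  have := isIntegral_adjoin_range hw he hg hN
  exact (Algebra.IsAlgebraic.isTranscendenceBasis_of_lift_le_trdeg_of_finite K g (by simp)).1

end Integral

/-! ### Regular sequences of full length cut out only the origin -/

section ZeroDimensional

variable {K : Type*} [Field K] {n : ℕ}

/-- Each quotient by a nonzerodivisor lowers the Krull dimension by at least one. -/
lemma ringKrullDim_quotient_initialIdeal_add_le {A : Type*} [CommRing A] {m : ℕ} {f : Fin m → A}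
    (hf : ∀ (i : Fin m) (x), f i * x ∈ initialIdeal f i → x ∈ initialIdeal f i) {k : ℕ}
    (hk : k ≤ m) : ringKrullDim (A ⧸ initialIdeal f k) + k ≤ ringKrullDim A := by
  induction k with
  | zero =>
    simpa using ringKrullDim_quotient_le _
  | succ k ih =>
    set i : Fin m := ⟨k, hk⟩
    have hnzd : Ideal.Quotient.mk (initialIdeal f k) (f i) ∈
        nonZeroDivisors (A ⧸ initialIdeal f k) := by
      rw [mem_nonZeroDivisors_iff_right]
      intro x hx
      obtain ⟨x, rfl⟩ := Ideal.Quotient.mk_surjective x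
      rw [← map_mul, Ideal.Quotient.eq_zero_iff_mem, mul_comm] at hx
      exact Ideal.Quotient.eq_zero_iff_mem.2 (hf i x hx)
    have h1 := ringKrullDim_quotient_succ_le_of_nonZeroDivisor hnzd
    have e : (A ⧸ initialIdeal f k) ⧸ Ideal.span {Ideal.Quotient.mk (initialIdeal f k) (f i)} ≃+*
        A ⧸ initialIdeal f (k + 1) :=
      (Ideal.quotEquivOfEq (by rw [Ideal.map_span, Set.image_singleton])).trans
        ((DoubleQuot.quotQuotEquivQuotSup (initialIdeal f k) (Ideal.span {f i})).trans
          (Ideal.quotEquivOfEq (initialIdeal_succ f i).symm))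
    rw [ringKrullDim_eq_of_ringEquiv e] at h1
    refine le_trans ?_ (ih (by omega))
    refine le_trans (le_of_eq ?_) (add_le_add_left h1 _)
    push_cast
    rw [add_assoc, add_comm (1 : WithBot ℕ∞)]

lemma isArtinianRing_quotient_of_isRegularSeq {f : Fin n → MvPolynomial (Fin n) K}
    (hf : IsRegularSeq f) : IsArtinianRing (MvPolynomial (Fin n) K ⧸ Ideal.span (Set.range f)) := by
  have h := ringKrullDim_quotient_initialIdeal_add_le ((isRegularSeq_iff f).1 hf).1 le_rfl
  rw [MvPolynomial.ringKrullDim_of_isNoetherianRing, ringKrullDim_eq_zero_of_field, zero_add,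
    Nat.card_fin, initialIdeal_self] at h
  rw [isArtinianRing_iff_krullDimLE_zero, Ring.krullDimLE_iff]
  generalize ringKrullDim (MvPolynomial (Fin n) K ⧸ Ideal.span (Set.range f)) = r at h
  induction r with
  | bot => simp
  | coe r =>
    induction r with
    | top =>
      have h' : (⊤ : ℕ∞) + n ≤ n := by exact_mod_cast h
      simp at h'
    | coe r =>
      norm_cast at h ⊢
      omega

/-- The quotient is Artinian, so `X_j ^ (N + 1) y - X_j ^ N` lies in the ideal for some `N` and `y`.
Its component of degree `N w_j` is `-X_j ^ N`, since the other term starts in higher degree. -/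
lemma exists_X_pow_mem_of_isRegularSeq {w : Fin n → ℕ} (hw : ∀ i, 0 < w i) {d : Fin n → ℕ}
    {f : Fin n → MvPolynomial (Fin n) K} (hf : ∀ i, (f i).IsWeightedHomogeneous w (d i))
    (hreg : IsRegularSeq f) : ∃ N, ∀ j, X j ^ N ∈ Ideal.span (Set.range f) := by
  have := isArtinianRing_quotient_of_isRegularSeq hreg
  have h (j : Fin n) : ∃ N, X j ^ N ∈ Ideal.span (Set.range f) := by
    obtain ⟨N, y, hy⟩ := IsArtinian.exists_pow_succ_smul_dvd
      (Ideal.Quotient.mk (Ideal.span (Set.range f)) (X j))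
      (1 : MvPolynomial (Fin n) K ⧸ Ideal.span (Set.range f))
    obtain ⟨y, rfl⟩ := Ideal.Quotient.mk_surjective y
    rw [smul_eq_mul, smul_eq_mul, mul_one, ← map_pow, ← map_pow, ← map_mul, Ideal.Quotient.eq] at hy
    refine ⟨N, ?_⟩
    have h1 := component_mem_span (w := w) (by rintro _ ⟨i, rfl⟩; exact ⟨_, hf i⟩) hy (N * w j)
    have hX (l : ℕ) : (X j ^ l : MvPolynomial (Fin n) K).IsWeightedHomogeneous w (l * w j) := by
      simpa using (isWeightedHomogeneous_X K w j).pow l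
    rw [map_sub, weightedHomogeneousComponent_mul_of_lt (hX _) _
      (Nat.mul_lt_mul_of_pos_right N.lt_succ_self (hw j)), zero_sub,
      (hX N).weightedHomogeneousComponent_same] at h1
    exact neg_mem_iff.1 h1
  choose N hN using h
  refine ⟨∑ j, N j, fun j => ?_⟩
  exact Ideal.mem_of_dvd _ (pow_dvd_pow _ (Finset.single_le_sum (fun _ _ => Nat.zero_le _)
    (Finset.mem_univ j))) (hN j)

end ZeroDimensional

/-! ### Noether position: a criterion and its density -/

section NoetherPosition

variable {K : Type*} [Field K] {n m : ℕ} {w : Fin n → ℕ}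

/-- If the members of a one-parameter family of weighted homogeneous sequences generate at the
parameter `0` an ideal that contains powers of all variables, they do so at all but finitely many
parameters. -/
lemma exists_X_pow_mem_of_eval_ne_zero {r : ℕ} (hw : ∀ i, 0 < w i)
    {g : Fin r → MvPolynomial (Fin n) (Polynomial K)} {e : Fin r → ℕ}
    (hg : ∀ i, (g i).IsWeightedHomogeneous w (e i)) {N : ℕ}
    (hN : ∀ j, X j ^ N ∈ Ideal.span (Set.range fun i => specialize 0 (g i))) :
    ∃ (h : Polynomial K) (M : ℕ), h ≠ 0 ∧ ∀ c, h.eval c ≠ 0 →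
      ∀ j, X j ^ M ∈ Ideal.span (Set.range fun i => specialize c (g i)) := by
  -- At `t = 0` every form of degree `M w_j` lies in the ideal, so Nakayama applies to the whole
  -- graded piece containing `X_j ^ M`.
  set M := N * ∑ j, w j + 1
  have hX (j : Fin n) : (X j ^ M : MvPolynomial (Fin n) (Polynomial K)).IsWeightedHomogeneous w
      (M * w j) := by
    simpa using (isWeightedHomogeneous_X (Polynomial K) w j).pow M
  have key (j : Fin n) : ∃ p : Polynomial K, p.eval 0 = 1 ∧ C p * X j ^ M ∈ initialIdeal g r := by
    obtain ⟨p, hp, hpE⟩ := exists_eval_zero_eq_one_of_le hw (k := M * w j) le_rfl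
      (I := initialIdeal g r) (by
        intro x hx
        have h0 : specialize 0 x ∈ initialIdeal (fun i => specialize 0 (g i)) r := by
          rw [initialIdeal_self]
          refine mem_of_forall_X_pow_mem hN ?_ (IsWeightedHomogeneous.specialize hx 0)
          exact (Nat.lt_succ_self _).trans_le (Nat.le_mul_of_pos_right _ (hw j))
        obtain ⟨y, hy, z, hyz⟩ := exists_eq_add_of_specialize_mem h0
        rw [Polynomial.C_0, sub_zero] at hyz
        refine ⟨_, component_mem_initialIdeal hg hy (M * w j), _,
          weightedHomogeneousComponent_mem w z (M * w j), ?_⟩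
        rw [← weightedHomogeneousComponent_C_mul, ← map_add, ← hyz,
          IsWeightedHomogeneous.weightedHomogeneousComponent_same hx])
    exact ⟨p, hp, hpE _ (hX j)⟩
  choose p hp hpI using key
  refine ⟨∏ j, p j, M, Finset.prod_ne_zero_iff.2 fun j _ h => by simpa [h] using hp j, ?_⟩
  intro c hc j
  rw [Polynomial.eval_prod, Finset.prod_ne_zero_iff] at hc
  have h1 := map_mem_initialIdeal (specialize c) (hpI j)
  rw [initialIdeal_self, map_mul, specialize_C, map_pow, specialize_X] at h1
  have h2 := Ideal.mul_mem_left _ (C ((p j).eval c)⁻¹) h1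
  rwa [← mul_assoc, ← C_mul, inv_mul_cancel₀ (hc j (Finset.mem_univ j)), C_1, one_mul] at h2

/-- The sequence `f` in `K[X_1, …, X_n]`, completed by the variables `X_{m+1}, …, X_n`. -/
noncomputable def completeByX {R : Type*} [CommRing R] (f : Fin m → MvPolynomial (Fin n) R)
    (j : Fin n) : MvPolynomial (Fin n) R :=
  if h : (j : ℕ) < m then f ⟨j, h⟩ else X j

lemma completeByX_castLE {R : Type*} [CommRing R] (hmn : m ≤ n)
    (f : Fin m → MvPolynomial (Fin n) R) (i : Fin m) : completeByX f (Fin.castLE hmn i) = f i := by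
  simp [completeByX]

lemma completeByX_of_le {R : Type*} [CommRing R] (f : Fin m → MvPolynomial (Fin n) R) {j : Fin n}
    (hj : m ≤ j) : completeByX f j = X j := by
  simp [completeByX, hj.not_gt]

/-- The weighted degrees of a sequence completed by variables. -/
def completeDegrees (w : Fin n → ℕ) (d : Fin m → ℕ) (j : Fin n) : ℕ :=
  if h : (j : ℕ) < m then d ⟨j, h⟩ else w j

lemma completeDegrees_pos (hw : ∀ i, 0 < w i) {d : Fin m → ℕ} (hd : ∀ i, 0 < d i) (j : Fin n) :
    0 < completeDegrees w d j := by
  unfold completeDegrees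
  split_ifs with h
  exacts [hd _, hw _]

lemma isWeightedHomogeneous_completeByX {R : Type*} [CommRing R] {d : Fin m → ℕ}
    {f : Fin m → MvPolynomial (Fin n) R} (hf : ∀ i, (f i).IsWeightedHomogeneous w (d i))
    (j : Fin n) : (completeByX f j).IsWeightedHomogeneous w (completeDegrees w d j) := by
  unfold completeByX completeDegrees
  split_ifs with h
  exacts [hf _, isWeightedHomogeneous_X _ _ _]

lemma specialize_completeByX (c : K) (f : Fin m → MvPolynomial (Fin n) (Polynomial K)) :
    (fun j => specialize c (completeByX f j)) = completeByX fun i => specialize c (f i) := by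
  ext1 j
  unfold completeByX
  split_ifs <;> simp

lemma aeval_eq_self_of_mem_supported {s : Set (Fin n)} {g : Fin n → MvPolynomial (Fin n) K}
    (hg : ∀ j ∈ s, g j = X j) {p : MvPolynomial (Fin n) K} (hp : p ∈ supported K s) :
    aeval g p = p := by
  have : supported K s ≤ AlgHom.equalizer (aeval g) (AlgHom.id K (MvPolynomial (Fin n) K)) := by
    refine Algebra.adjoin_le ?_
    rintro _ ⟨j, hj, rfl⟩
    simp [hg j hj]
  exact this hp

/-- A weighted homogeneous sequence that generates together with `X_{m+1}, …, X_n` an ideal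
containing powers of all variables is in Noether position. -/
lemma isNoetherPosition_of_X_pow_mem (hmn : m ≤ n) (hw : ∀ i, 0 < w i) {d : Fin m → ℕ}
    (hd : ∀ i, 0 < d i) {f : Fin m → MvPolynomial (Fin n) K}
    (hf : ∀ i, (f i).IsWeightedHomogeneous w (d i)) {N : ℕ}
    (hN : ∀ j, X j ^ N ∈ Ideal.span (Set.range (completeByX f : Fin n → _))) :
    IsNoetherPosition hmn f := by
  set g : Fin n → MvPolynomial (Fin n) K := completeByX f with hg
  have hint := isIntegral_adjoin_range hw (completeDegrees_pos hw hd)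
    (isWeightedHomogeneous_completeByX hf) hN
  have hind := algebraicIndependent_of_X_pow_mem_span hw (completeDegrees_pos hw hd)
    (isWeightedHomogeneous_completeByX hf) hN
  rw [← hg] at hint hind
  set S := Algebra.adjoin K (Set.range g)
  set A := supported K {j : Fin n | m ≤ (j : ℕ)}
  set I := Ideal.span (Set.range f) with hI
  constructor
  · intro i
    -- Modulo `I` the `f_i` vanish, so elements of `S` reduce to elements of `A`; monic equations
    -- over `S` thus become monic equations over `A`.
    have hS : ∀ s ∈ S, ∃ a ∈ A, Ideal.Quotient.mk I s = Ideal.Quotient.mk I a := by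
      intro s hs
      have hle : S ≤ (A.map (Ideal.Quotient.mkₐ K I)).comap (Ideal.Quotient.mkₐ K I) := by
        refine Algebra.adjoin_le ?_
        rintro _ ⟨j, rfl⟩
        by_cases hj : (j : ℕ) < m
        · refine ⟨0, zero_mem _, ?_⟩
          rw [map_zero, eq_comm]
          refine Ideal.Quotient.eq_zero_iff_mem.2 (Ideal.subset_span ⟨⟨j, hj⟩, ?_⟩)
          exact (completeByX_castLE hmn f ⟨j, hj⟩).symm
        · refine ⟨X j, X_mem_supported.2 (not_lt.1 hj), ?_⟩
          rw [hg, completeByX_of_le f (not_lt.1 hj)]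
      obtain ⟨a, ha, h⟩ := hle hs
      exact ⟨a, ha, h.symm⟩
    obtain ⟨p, hp, hpX⟩ := hint.isIntegral (X (Fin.castLE hmn i) : MvPolynomial (Fin n) K)
    let φ : S →+* MvPolynomial (Fin n) K ⧸ I := (Ideal.Quotient.mk I).comp S.subtype
    have hlift : p.map φ ∈ Polynomial.lifts (algebraMap A (MvPolynomial (Fin n) K ⧸ I)) := by
      rw [Polynomial.lifts_iff_coeff_lifts]
      intro k
      obtain ⟨a, ha, h⟩ := hS _ (p.coeff k).2
      rw [Polynomial.coeff_map]
      exact ⟨⟨a, ha⟩, h.symm⟩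
    obtain ⟨q, hq, -, hqm⟩ := Polynomial.lifts_and_natDegree_eq_and_monic hlift (hp.map φ)
    refine ⟨q, hqm, ?_⟩
    rw [← Polynomial.eval_map, hq, Polynomial.eval_map, ← map_zero (Ideal.Quotient.mk I), ← hpX,
      Polynomial.hom_eval₂]
    rfl
  · intro p hp hpI
    -- As `S` is a polynomial ring in the `g j`, setting the `f_i` to zero has a prime kernel. Lying
    -- over gives an ideal `Q ⊇ I` contracting to it, and this kernel meets `A` only in zero.
    let φ : MvPolynomial (Fin n) K →ₐ[K] MvPolynomial (Fin n) K :=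
      aeval fun j => if (j : ℕ) < m then 0 else X j
    let E := hind.aevalEquiv
    have hE (x : MvPolynomial (Fin n) K) : (E x : MvPolynomial (Fin n) K) = aeval g x := by
      simp [E]
    have : (RingHom.ker (φ.comp E.symm.toAlgHom)).IsPrime := RingHom.ker_isPrime _
    obtain ⟨Q, -, -, hQ⟩ := Ideal.exists_ideal_over_prime_of_isIntegral
      (RingHom.ker (φ.comp E.symm.toAlgHom)) (⊥ : Ideal (MvPolynomial (Fin n) K))
      (by
        intro x hx
        have : x = 0 := Subtype.ext hx
        rw [this]; exact zero_mem _)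
    have hmem (x : MvPolynomial (Fin n) K) : aeval g x ∈ Q ↔ φ x = 0 := by
      rw [← hE]
      have : E x ∈ Q.comap (algebraMap S (MvPolynomial (Fin n) K)) ↔ φ x = 0 := by
        rw [hQ, RingHom.mem_ker]
        simp
      exact this
    have hIQ : I ≤ Q := by
      rw [hI, Ideal.span_le]
      rintro _ ⟨i, rfl⟩
      have := (hmem (X (Fin.castLE hmn i))).2 (by simp [φ])
      rwa [aeval_X, hg, completeByX_castLE] at this
    have h1 : aeval g p = p :=
      aeval_eq_self_of_mem_supported (fun j hj => completeByX_of_le f hj) hp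
    have h2 : φ p = p := by
      refine aeval_eq_self_of_mem_supported (fun j hj => ?_) hp
      rw [if_neg (not_lt.2 hj)]
    rw [← h2, ← hmem, h1]
    exact hIQ hpI

lemma exists_X_pow_mem_of_isCompatible_trunc (hmn : m ≤ n) (hw : ∀ i, 0 < w i) {d : Fin m → ℕ}
    (h : IsCompatible K (trunc hmn w) d) :
    ∃ (F : HomSeq K w d) (N : ℕ),
      ∀ j, X j ^ N ∈ Ideal.span (Set.range (completeByX F.polys : Fin n → _)) := by
  obtain ⟨F', hF'⟩ := h
  obtain ⟨N, hN⟩ := exists_X_pow_mem_of_isRegularSeq (w := trunc hmn w) (fun i => hw _)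
    F'.isWeightedHomogeneous hF'
  have hinj : Function.Injective (Fin.castLE hmn) := Fin.castLE_injective hmn
  refine ⟨fun i => ⟨rename (Fin.castLE hmn) (F'.polys i), ?_⟩, N + 1, fun j => ?_⟩
  · intro a ha
    obtain ⟨b, rfl, hb⟩ := coeff_rename_ne_zero _ _ _ ha
    rw [← F'.isWeightedHomogeneous i hb, Finsupp.weight_apply, Finsupp.weight_apply,
      Finsupp.sum_mapDomain_index (by simp) (by intros; simp [add_mul])]
    rfl
  · rcases lt_or_ge (j : ℕ) m with hj | hj
    · have h1 := Ideal.mem_map_of_mem (rename (Fin.castLE hmn) : _ →ₐ[K] _) (hN ⟨j, hj⟩)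
      rw [Ideal.map_span, map_pow, rename_X] at h1
      rw [pow_succ]
      refine Ideal.mul_mem_right _ _ (Ideal.span_mono ?_ h1)
      rintro _ ⟨_, ⟨i, rfl⟩, rfl⟩
      exact ⟨Fin.castLE hmn i, completeByX_castLE hmn _ i⟩
    · rw [pow_succ]
      -- The exponent `N + 1` is positive even if `N = 0`, so it suffices that `X j` is itself a
      -- generator.
      exact Ideal.mul_mem_left _ _ (Ideal.subset_span ⟨j, completeByX_of_le _ hj⟩)

lemma isZariskiDense_isNoetherPosition [Infinite K] (hmn : m ≤ n) (hw : ∀ i, 0 < w i)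
    {d : Fin m → ℕ} (hd : ∀ i, 0 < d i) (h : IsCompatible K (trunc hmn w) d) :
    IsZariskiDense {F : HomSeq K w d | IsNoetherPosition hmn F.polys} := by
  obtain ⟨F₀, N, hN⟩ := exists_X_pow_mem_of_isCompatible_trunc hmn hw h
  refine isZariskiDense_of_lines F₀ fun G => ?_
  have hspec (c : K) : (fun j => specialize c (completeByX (linePolys F₀ G) j)) =
      (completeByX (F₀ + c • G).polys : Fin n → _) := by
    rw [specialize_completeByX, specialize_linePolys]
  obtain ⟨h, M, h0, hh⟩ := exists_X_pow_mem_of_eval_ne_zero hw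
    (isWeightedHomogeneous_completeByX (linePolys_isWeightedHomogeneous F₀ G)) (N := N)
    (by simpa only [hspec, zero_smul, add_zero] using hN)
  refine (Polynomial.finite_setOfPred_isRoot h0).subset fun c hc => ?_
  by_contra hne
  refine hc (isNoetherPosition_of_X_pow_mem hmn hw hd (F₀ + c • G).isWeightedHomogeneous
    (N := M) ?_)
  simpa only [hspec] using hh c hne

end NoetherPosition

/-! ### Powers of variables as regular sequences -/

section StronglyCompatible

variable {K : Type*} [Field K] {n m : ℕ} {w : Fin n → ℕ} {d : Fin m → ℕ}

lemma mem_initialIdeal_X_pow_iff (hmn : m ≤ n) (e : Fin m → ℕ) {k : ℕ}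
    {x : MvPolynomial (Fin n) K} :
    x ∈ initialIdeal (fun i : Fin m => (X (Fin.castLE hmn i) ^ e i : MvPolynomial (Fin n) K)) k ↔
      ∀ a ∈ x.support, ∃ j : Fin m, (j : ℕ) < k ∧ e j ≤ a (Fin.castLE hmn j) := by
  have : (fun i : Fin m => (X (Fin.castLE hmn i) ^ e i : MvPolynomial (Fin n) K)) =
      (fun s => monomial s 1) ∘ fun i => Finsupp.single (Fin.castLE hmn i) (e i) := by
    ext1 i; simp [X_pow_eq_monomial]
  rw [initialIdeal, this, Set.image_comp, mem_ideal_span_monomial_image]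
  simp

/-- A strongly compatible sequence of degrees is compatible: powers of variables form a regular
sequence. -/
lemma IsStronglyCompatible.isCompatible (hmn : m ≤ n) (hd : ∀ i, 0 < d i)
    (h : IsStronglyCompatible hmn w d) : IsCompatible K w d := by
  choose e he using h
  have hhom (i : Fin m) : (X (Fin.castLE hmn i) ^ e i : MvPolynomial (Fin n) K) ∈
      weightedHomogeneousSubmodule K w (d i) := by
    have := (isWeightedHomogeneous_X K w (Fin.castLE hmn i)).pow (e i)
    rwa [smul_eq_mul, mul_comm, ← he] at this
  let F : HomSeq K w d := fun i => ⟨_, hhom i⟩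
  refine ⟨F, (isRegularSeq_iff_of_homogeneous hd F.isWeightedHomogeneous).2 fun i x hx => ?_⟩
  have hF : F.polys = fun i => X (Fin.castLE hmn i) ^ e i := rfl
  rw [hF, mem_initialIdeal_X_pow_iff] at hx ⊢
  intro a ha
  -- Multiplication by `X_i ^ e_i` leaves the exponents of the earlier variables unchanged.
  obtain ⟨j, hj, hja⟩ := hx (Finsupp.single (Fin.castLE hmn i) (e i) + a) (by
    rw [mem_support_iff] at ha ⊢
    dsimp only
    rwa [X_pow_eq_monomial, coeff_monomial_mul, one_mul])
  refine ⟨j, hj, ?_⟩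
  have hne : Fin.castLE hmn i ≠ Fin.castLE hmn j := fun h => by
    simp [Fin.ext_iff] at h; omega
  simpa [Finsupp.single_apply, hne] using hja

end StronglyCompatible

/-! ### Reordering the degrees for reverse chain-divisible weights -/

section ReverseChainDivisible

variable {K : Type*} [Field K] {n : ℕ} {w d : Fin n → ℕ}

lemma IsReverseChainDivisible.dvd (h : IsReverseChainDivisible w) {i j : Fin n} (hij : i ≤ j) :
    w j ∣ w i := by
  obtain ⟨i, hi⟩ := i
  obtain ⟨j, hj⟩ := j
  replace hij : i ≤ j := hij
  induction j, hij using Nat.le_induction with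
  | base => rfl
  | succ j hij ih => exact (h ⟨j, by omega⟩ ⟨j + 1, hj⟩ rfl).trans (ih (by omega))

/-- For reverse chain-divisible weights, at least `j` of the degrees of a regular sequence of full
length are divisible by the `j`-th weight. -/
lemma lt_card_filter_dvd (hw : ∀ i, 0 < w i) (hd : ∀ i, 0 < d i) (h : IsCompatible K w d)
    (hdvd : IsReverseChainDivisible w) (j : Fin n) :
    (j : ℕ) < (Finset.univ.filter fun i => w j ∣ d i).card := by
  classical
  obtain ⟨F, hF⟩ := h
  obtain ⟨N, hN⟩ := exists_X_pow_mem_of_isRegularSeq hw F.isWeightedHomogeneous hF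
  let g : {i // w j ∣ d i} ⊕ {l // j < l} → MvPolynomial (Fin n) K :=
    Sum.elim (fun i => F.polys i) (fun l => X l)
  have hle : Ideal.span (Set.range F.polys) ≤ Ideal.span (Set.range g) := by
    rw [Ideal.span_le]
    rintro _ ⟨i, rfl⟩
    by_cases hi : w j ∣ d i
    · exact Ideal.subset_span ⟨Sum.inl ⟨i, hi⟩, rfl⟩
    -- A monomial in the variables up to `X_j` alone has degree divisible by `w j`, which divides
    -- all their weights.
    · have h1 : F.polys i ∈ Ideal.span ((X : Fin n → MvPolynomial (Fin n) K) '' {l | j < l}) := by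
        rw [mem_ideal_span_X_image]
        intro a ha
        by_contra! hcon
        refine hi ?_
        rw [← F.isWeightedHomogeneous i (mem_support_iff.1 ha), Finsupp.weight_apply,
          Finsupp.sum_fintype _ _ (by simp)]
        refine Finset.dvd_sum fun l _ => ?_
        rcases le_or_gt l j with hl | hl
        · exact (hdvd.dvd hl).mul_left _
        · rw [hcon l hl, zero_smul]; exact dvd_zero _
      refine Ideal.span_mono ?_ h1
      rintro _ ⟨l, hl, rfl⟩
      exact ⟨Sum.inr ⟨l, hl⟩, rfl⟩
  have hcard := le_card_of_X_pow_mem_span hw (g := g)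
    (e := Sum.elim (fun i => d i) (fun l => w l))
    (by rintro (i | l); exacts [hd _, hw _])
    (by rintro (i | l); exacts [F.isWeightedHomogeneous _, isWeightedHomogeneous_X _ _ _])
    (fun l => hle (hN l))
  rw [Fintype.card_sum, Fintype.card_subtype, Fintype.card_subtype] at hcard
  -- Indices start at 0: at least `n` generators, of which `n - 1 - j` are variables, leave at least
  -- `j + 1` degrees.
  have h2 : (Finset.univ.filter fun l => j < l).card = n - 1 - j := by
    rw [Finset.filter_lt_eq_Ioi, Fin.card_Ioi]
  have := j.2
  omega

lemma exists_perm_isStronglyCompatible (hw : ∀ i, 0 < w i) (hd : ∀ i, 0 < d i)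
    (h : IsCompatible K w d) (hdvd : IsReverseChainDivisible w) :
    ∃ σ : Equiv.Perm (Fin n), ∀ i, w i ∣ d (σ i) := by
  classical
  obtain ⟨f, hf, hfd⟩ := (Finset.all_card_le_biUnion_card_iff_exists_injective
    fun i => Finset.univ.filter fun l => w i ∣ d l).1 (by
      intro s
      rcases s.eq_empty_or_nonempty with rfl | hs
      · simp
      -- Hall's condition already follows from the neighbours of the largest index of `s`.
      · have h1 : s ⊆ Finset.Iic (s.max' hs) := fun i hi => Finset.mem_Iic.2 (s.le_max' i hi)
        have h2 := Finset.card_le_card h1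
        rw [Fin.card_Iic] at h2
        exact (h2.trans (lt_card_filter_dvd hw hd h hdvd _)).trans
          (Finset.card_le_card (Finset.subset_biUnion_of_mem
            (fun i => Finset.univ.filter fun l => w i ∣ d l) (s.max'_mem hs))))
  exact ⟨Equiv.ofBijective f (Finite.injective_iff_bijective.1 hf),
    fun i => (Finset.mem_filter.1 (hfd i)).2⟩

end ReverseChainDivisible

end WeightedSeq

theorem mainTheorem8 {K : Type*} [Field K] (n m : ℕ) (hmn : m ≤ n)
    (w : Fin n → ℕ) (hw : ∀ i, 0 < w i) (d : Fin m → ℕ) (hd : ∀ i, 0 < d i) :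
    (Infinite K → WeightedSeq.IsCompatible K w d →
      WeightedSeq.IsZariskiDense
        {F : WeightedSeq.HomSeq K w d | WeightedSeq.IsRegularSeq F.polys}) ∧
    (Infinite K → WeightedSeq.IsCompatible K (WeightedSeq.trunc hmn w) d →
      WeightedSeq.IsZariskiDense
        {F : WeightedSeq.HomSeq K w d | WeightedSeq.IsNoetherPosition hmn F.polys}) ∧
    (WeightedSeq.IsStronglyCompatible hmn w d →
      WeightedSeq.IsCompatible K w d ∧
      WeightedSeq.IsCompatible K (WeightedSeq.trunc hmn w) d ∧
      ∀ (i : ℕ) (hi : i ≤ m),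
        WeightedSeq.IsCompatible K
          (WeightedSeq.trunc (hi.trans hmn) w) (WeightedSeq.trunc hi d)) ∧
    (m = n → WeightedSeq.IsCompatible K w d → WeightedSeq.IsReverseChainDivisible w →
      ∃ σ : Equiv.Perm (Fin m), WeightedSeq.IsStronglyCompatible hmn w (d ∘ σ)) := by
  refine ⟨fun _ h => WeightedSeq.isZariskiDense_isRegularSeq hw hd h,
    fun _ h => WeightedSeq.isZariskiDense_isNoetherPosition hmn hw hd h, fun h => ⟨?_, ?_, ?_⟩, ?_⟩
  · exact h.isCompatible hmn hd
  · exact WeightedSeq.IsStronglyCompatible.isCompatible le_rfl hd fun i => h i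
  · intro i hi
    exact WeightedSeq.IsStronglyCompatible.isCompatible le_rfl (fun j => hd _)
      fun j => h (Fin.castLE hi j)
  · rintro rfl h hdvd
    exact WeightedSeq.exists_perm_isStronglyCompatible hw hd h hdvd
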